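/- Let $(\Omega,\Sigma,\mu)$ be a probability space with $\mu$ non-atomic (every measurable set of positive measure contains a measurable subset of strictly smaller positive measure), and let $X$ be a real or complex Banach space whose dual $X^*$ has the Radon–Nikodým property with respect to $\mu$ (in particular, $X^*$ may be any dual space with the Radon–Nikodým property): for every countably additive vector measure $G:\Sigma\to X^*$ of bounded variation that vanishes on $\mu$-null sets there is a Bochner integrable $g:\Omega\to X^*$ with $G(A)=\int_A g\,d\mu$ for all $A\in\Sigma$. Let $L^1(\mu,X)$ be the Banach space of (classes of) Bochner integrable functions $\Omega\to X$ with norm $\|f\|=\int_\Omega\|f(\omega)\|\,d\mu(\omega)$. Let $f\in L^1(\mu,X)$ with $\|f\|=1$, and let $$S_f=\{\varphi\in L^1(\mu,X)^*:\ \|\varphi\|=1=\varphi(f)\}$$ be its state space. If $S_f$ is compact in the weak topology of the Banach space $L^1(\mu,X)^*$, or compact in its norm topology, then $f$ is a smooth point of $L^1(\mu,X)$, that is, $S_f$ is a singleton. -/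

import Mathlib

open MeasureTheory

/-- `μ` is non-atomic: every measurable set of positive measure contains a measurable subset of
strictly smaller positive measure. -/
def IsNonatomic {Ω : Type*} [MeasurableSpace Ω] (μ : Measure Ω) : Prop :=
  ∀ s : Set Ω, MeasurableSet s → 0 < μ s →
    ∃ t : Set Ω, t ⊆ s ∧ MeasurableSet t ∧ 0 < μ t ∧ μ t < μ s

/-- `E` has the Radon–Nikodým property with respect to `μ`: every countably additive `E`-valued
measure of bounded variation that vanishes on the `μ`-null sets has a Bochner integrable density
with respect to `μ`. (A Banach space has the Radon–Nikodým property if this holds for every finite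
measure `μ`.) -/
def HasRNPWith {Ω : Type*} [MeasurableSpace Ω] (μ : Measure Ω)
    (E : Type*) [NormedAddCommGroup E] [NormedSpace ℝ E] : Prop :=
  ∀ G : VectorMeasure Ω E, G.variation Set.univ < ⊤ →
    (∀ s : Set Ω, MeasurableSet s → μ s = 0 → G s = 0) →
    ∃ g : Ω → E, Integrable g μ ∧ ∀ s : Set Ω, MeasurableSet s → G s = ∫ ω in s, g ω ∂μ

/-- The state space of a vector `x`: the norm-one functionals that take the value `1` at `x`. -/
def stateSpace (𝕜 : Type*) [RCLike 𝕜] {E : Type*} [NormedAddCommGroup E] [NormedSpace 𝕜 E]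
    (x : E) : Set (StrongDual 𝕜 E) :=
  {φ | ‖φ‖ = 1 ∧ φ x = 1}

/-- `K` is weakly compact, i.e. compact for the topology on `E` induced by the dual of `E`. -/
def IsWeaklyCompact (𝕜 : Type*) [RCLike 𝕜] {E : Type*} [NormedAddCommGroup E] [NormedSpace 𝕜 E]
    (K : Set E) : Prop :=
  IsCompact (toWeakSpace 𝕜 E '' K)

/-- A unit vector is a smooth point if its state space is a singleton. -/
def IsSmoothPoint (𝕜 : Type*) [RCLike 𝕜] {E : Type*} [NormedAddCommGroup E] [NormedSpace 𝕜 E]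
    (x : E) : Prop :=
  ‖x‖ = 1 ∧ ∃ φ : StrongDual 𝕜 E, stateSpace 𝕜 x = {φ}

open Filter Topology

/-! Let `φ₁ ≠ φ₂` be states and `ψ = φ₁ - φ₂`. The `L¹` norm adds over disjoint pieces, so using
`φ₂` on `D` and `φ₁` off `D` gives a state again (`splice_mem_stateSpace`). Dually, the norm of `ψ`
localized to a union is at most the maximum of the localized norms; an ultrafilter argument and
non-atomicity then give sets `D n` decreasing to `∅` on which `ψ` keeps its full norm
(`IsNonatomic.exists_antitone_localNorm_eq`). The splices along `D n` tend pointwise to `φ₁`, so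
weak compactness and Mazur's theorem put `φ₁` in the norm closure of the functionals agreeing with
`φ₂` on some `D n`. Each of these is at distance at least `‖ψ‖` from `φ₁`, a contradiction. -/

section Restriction

variable {𝕜 : Type*} [RCLike 𝕜] {Ω : Type*} [MeasurableSpace Ω] {μ : Measure Ω}
  {X : Type*} [NormedAddCommGroup X] [NormedSpace 𝕜 X]

/-- The class of `f · 1_A`, for an integrable function class `f`. -/
noncomputable def L1.indicator {A : Set Ω} (hA : MeasurableSet A) (f : Lp X 1 μ) : Lp X 1 μ :=
  ((Lp.memLp f).indicator hA).toLp (A.indicator f)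

theorem L1.coeFn_indicator {A : Set Ω} (hA : MeasurableSet A) (f : Lp X 1 μ) :
    L1.indicator hA f =ᵐ[μ] A.indicator f :=
  MemLp.coeFn_toLp _

theorem L1.norm_indicator {A : Set Ω} (hA : MeasurableSet A) (f : Lp X 1 μ) :
    ‖L1.indicator hA f‖ = ∫ ω in A, ‖f ω‖ ∂μ := by
  rw [L1.norm_eq_integral_norm, ← integral_indicator hA]
  refine integral_congr_ae ?_
  filter_upwards [L1.coeFn_indicator hA f] with ω hω
  rw [hω, norm_indicator_eq_indicator_norm]

theorem L1.norm_indicator_add_compl {A : Set Ω} (hA : MeasurableSet A) (f : Lp X 1 μ) :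
    ‖L1.indicator hA f‖ + ‖L1.indicator hA.compl f‖ = ‖f‖ := by
  rw [L1.norm_indicator, L1.norm_indicator, L1.norm_eq_integral_norm]
  exact integral_add_compl hA (L1.integrable_coeFn f).norm

theorem L1.norm_indicator_le {A : Set Ω} (hA : MeasurableSet A) (f : Lp X 1 μ) :
    ‖L1.indicator hA f‖ ≤ ‖f‖ := by
  linarith [L1.norm_indicator_add_compl hA f, norm_nonneg (L1.indicator hA.compl f)]

variable (𝕜) in
/-- Multiplication by the indicator function of `A`, as an operator on `L¹(μ, X)`. -/
noncomputable def L1.indicatorCLM {A : Set Ω} (hA : MeasurableSet A) :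
    Lp X 1 μ →L[𝕜] Lp X 1 μ :=
  LinearMap.mkContinuous
    { toFun := L1.indicator hA
      map_add' := fun f g => by
        refine Lp.ext ?_
        filter_upwards [L1.coeFn_indicator hA (f + g), L1.coeFn_indicator hA f,
          L1.coeFn_indicator hA g, Lp.coeFn_add f g,
          Lp.coeFn_add (L1.indicator hA f) (L1.indicator hA g)] with ω h₁ h₂ h₃ h₄ h₅
        rw [h₅, Pi.add_apply, h₁, h₂, h₃]
        by_cases hω : ω ∈ A
        · simpa [hω] using h₄
        · simp [hω]
      map_smul' := fun c f => by
        refine Lp.ext ?_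
        filter_upwards [L1.coeFn_indicator hA (c • f), L1.coeFn_indicator hA f,
          Lp.coeFn_smul c f, Lp.coeFn_smul c (L1.indicator hA f)] with ω h₁ h₂ h₃ h₄
        rw [RingHom.id_apply, h₄, Pi.smul_apply, h₁, h₂]
        by_cases hω : ω ∈ A <;> simp [hω, h₃] }
    1 (fun f => by simpa using L1.norm_indicator_le hA f)

@[simp]
theorem L1.indicatorCLM_apply {A : Set Ω} (hA : MeasurableSet A) (f : Lp X 1 μ) :
    L1.indicatorCLM 𝕜 hA f = L1.indicator hA f := rfl

theorem L1.indicator_indicator {A B : Set Ω} (hA : MeasurableSet A) (hB : MeasurableSet B)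
    (f : Lp X 1 μ) :
    L1.indicator hA (L1.indicator hB f) = L1.indicator (hA.inter hB) f := by
  refine Lp.ext ?_
  filter_upwards [L1.coeFn_indicator hA (L1.indicator hB f), L1.coeFn_indicator hB f,
    L1.coeFn_indicator (hA.inter hB) f] with ω h₁ h₂ h₃
  rw [h₁, h₃, ← Set.indicator_indicator]
  by_cases hω : ω ∈ A <;> simp [hω, h₂]

theorem L1.indicator_indicator_of_subset {A B : Set Ω} (hA : MeasurableSet A)
    (hB : MeasurableSet B) (hAB : A ⊆ B) (f : Lp X 1 μ) :
    L1.indicator hB (L1.indicator hA f) = L1.indicator hA f := by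
  rw [L1.indicator_indicator]
  congr 1
  exact Set.inter_eq_right.2 hAB

theorem L1.indicator_add_indicator_compl {A : Set Ω} (hA : MeasurableSet A) (f : Lp X 1 μ) :
    L1.indicator hA f + L1.indicator hA.compl f = f := by
  refine Lp.ext ?_
  filter_upwards [Lp.coeFn_add (L1.indicator hA f) (L1.indicator hA.compl f),
    L1.coeFn_indicator hA f, L1.coeFn_indicator hA.compl f] with ω h₁ h₂ h₃
  rw [h₁, Pi.add_apply, h₂, h₃]
  exact Set.indicator_self_add_compl_apply A f ω

theorem L1.indicator_eq_zero {A : Set Ω} (hA : MeasurableSet A) (h : μ A = 0) (f : Lp X 1 μ) :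
    L1.indicator hA f = 0 := by
  rw [← norm_eq_zero, L1.norm_indicator, setIntegral_measure_zero _ h]

theorem L1.tendsto_indicator_zero {D : ℕ → Set Ω} (hD : ∀ n, MeasurableSet (D n))
    (hanti : Antitone D) (hempty : ⋂ n, D n = ∅) (f : Lp X 1 μ) :
    Tendsto (fun n => L1.indicator (hD n) f) atTop (𝓝 0) := by
  rw [tendsto_zero_iff_norm_tendsto_zero]
  simp only [L1.norm_indicator]
  have h := tendsto_setIntegral_of_antitone (μ := μ) (f := fun ω => ‖f ω‖) hD hanti
    ⟨0, (L1.integrable_coeFn f).norm.integrableOn⟩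
  simpa [hempty] using h

/-! ### The localized norm of a functional -/

/-- The norm of the restriction of `ψ` to the functions supported in `A`. -/
noncomputable def localNorm (ψ : StrongDual 𝕜 (Lp X 1 μ)) {A : Set Ω} (hA : MeasurableSet A) : ℝ :=
  ‖ψ.comp (L1.indicatorCLM 𝕜 hA)‖

theorem norm_apply_indicator_le (ψ : StrongDual 𝕜 (Lp X 1 μ)) {A B : Set Ω}
    (hA : MeasurableSet A) (hB : MeasurableSet B) (hAB : A ⊆ B) (f : Lp X 1 μ) :
    ‖ψ (L1.indicator hA f)‖ ≤ localNorm ψ hB * ‖L1.indicator hA f‖ := by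
  have h := (ψ.comp (L1.indicatorCLM 𝕜 hB)).le_opNorm (L1.indicator hA f)
  rwa [ContinuousLinearMap.comp_apply, L1.indicatorCLM_apply,
    L1.indicator_indicator_of_subset hA hB hAB] at h

theorem localNorm_mono (ψ : StrongDual 𝕜 (Lp X 1 μ)) {A B : Set Ω}
    (hA : MeasurableSet A) (hB : MeasurableSet B) (hAB : A ⊆ B) :
    localNorm ψ hA ≤ localNorm ψ hB := by
  refine ContinuousLinearMap.opNorm_le_bound _ (norm_nonneg _) fun f => ?_
  exact (norm_apply_indicator_le ψ hA hB hAB f).trans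
    (mul_le_mul_of_nonneg_left (L1.norm_indicator_le hA f) (norm_nonneg _))

theorem localNorm_univ (ψ : StrongDual 𝕜 (Lp X 1 μ)) :
    localNorm ψ MeasurableSet.univ = ‖ψ‖ := by
  unfold localNorm
  congr 1
  ext f
  have h := L1.indicator_add_indicator_compl MeasurableSet.univ f
  rw [L1.indicator_eq_zero MeasurableSet.univ.compl (by simp), add_zero] at h
  simp [h]

theorem localNorm_le_norm (ψ : StrongDual 𝕜 (Lp X 1 μ)) {A : Set Ω} (hA : MeasurableSet A) :
    localNorm ψ hA ≤ ‖ψ‖ :=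
  (localNorm_mono ψ hA MeasurableSet.univ (Set.subset_univ A)).trans (localNorm_univ ψ).le

theorem localNorm_eq_zero (ψ : StrongDual 𝕜 (Lp X 1 μ)) {A : Set Ω} (hA : MeasurableSet A)
    (h : μ A = 0) : localNorm ψ hA = 0 := by
  rw [localNorm, norm_eq_zero]
  ext f
  simp [L1.indicator_eq_zero hA h]

/-- Dual form of the additivity of the `L¹` norm: split along `A` and its complement and bound each
piece by the larger constant. -/
theorem localNorm_union_le (ψ : StrongDual 𝕜 (Lp X 1 μ)) {A B : Set Ω}
    (hA : MeasurableSet A) (hB : MeasurableSet B) :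
    localNorm ψ (hA.union hB) ≤ max (localNorm ψ hA) (localNorm ψ hB) := by
  set m := max (localNorm ψ hA) (localNorm ψ hB)
  have hm : 0 ≤ m := (norm_nonneg _).trans (le_max_left _ _)
  refine ContinuousLinearMap.opNorm_le_bound _ hm fun f => ?_
  rw [ContinuousLinearMap.comp_apply, L1.indicatorCLM_apply]
  set g := L1.indicator (hA.union hB) f with hg
  have hgB : L1.indicator hA.compl g = L1.indicator (hA.compl.inter (hA.union hB)) f :=
    L1.indicator_indicator _ _ _
  have h₁ : ‖ψ (L1.indicator hA g)‖ ≤ m * ‖L1.indicator hA g‖ :=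
    (norm_apply_indicator_le ψ hA hA subset_rfl g).trans
      (mul_le_mul_of_nonneg_right (le_max_left _ _) (norm_nonneg _))
  have h₂ : ‖ψ (L1.indicator hA.compl g)‖ ≤ m * ‖L1.indicator hA.compl g‖ := by
    rw [hgB]
    refine (norm_apply_indicator_le ψ _ hB ?_ f).trans
      (mul_le_mul_of_nonneg_right (le_max_right _ _) (norm_nonneg _))
    rintro ω ⟨h, h' | h'⟩
    · exact absurd h' h
    · exact h'
  calc ‖ψ g‖ = ‖ψ (L1.indicator hA g) + ψ (L1.indicator hA.compl g)‖ := by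
        rw [← map_add, L1.indicator_add_indicator_compl]
    _ ≤ ‖ψ (L1.indicator hA g)‖ + ‖ψ (L1.indicator hA.compl g)‖ := norm_add_le _ _
    _ ≤ m * ‖L1.indicator hA g‖ + m * ‖L1.indicator hA.compl g‖ := add_le_add h₁ h₂
    _ = m * ‖g‖ := by rw [← mul_add, L1.norm_indicator_add_compl]
    _ ≤ m * ‖f‖ := mul_le_mul_of_nonneg_left (L1.norm_indicator_le _ f) hm

/-- For a nonzero functional, there is an ultrafilter on whose measurable members the
functional keeps its full norm. -/
theorem exists_ultrafilter_localNorm_eq {ψ : StrongDual 𝕜 (Lp X 1 μ)} (hψ : ψ ≠ 0) :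
    ∃ U : Ultrafilter Ω, ∀ (A : Set Ω) (hA : MeasurableSet A), A ∈ U → localNorm ψ hA = ‖ψ‖ := by
  -- The sets of localized norm below `‖ψ‖` form a proper ideal, by the maximum bound; `F` is its
  -- dual filter.
  let F : Filter Ω :=
    { sets := {S | ∃ (A : Set Ω) (hA : MeasurableSet A), localNorm ψ hA < ‖ψ‖ ∧ Aᶜ ⊆ S}
      univ_sets := by
        refine ⟨∅, MeasurableSet.empty, ?_, Set.subset_univ _⟩
        rw [localNorm_eq_zero ψ _ measure_empty]
        exact norm_pos_iff.2 hψ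
      sets_of_superset := by
        rintro S T ⟨A, hA, h, hS⟩ hST
        exact ⟨A, hA, h, hS.trans hST⟩
      inter_sets := by
        rintro S T ⟨A, hA, h, hS⟩ ⟨B, hB, h', hT⟩
        refine ⟨A ∪ B, hA.union hB, (localNorm_union_le ψ hA hB).trans_lt (max_lt h h'), ?_⟩
        rw [Set.compl_union]
        exact Set.inter_subset_inter hS hT }
  have hF : F.NeBot := by
    refine ⟨fun hbot => ?_⟩
    obtain ⟨A, hA, h, hS⟩ : ∅ ∈ F := by rw [hbot]; exact mem_bot
    obtain rfl : A = Set.univ := Set.compl_empty_iff.1 (Set.subset_empty_iff.1 hS)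
    exact absurd (localNorm_univ ψ) h.ne
  refine ⟨Ultrafilter.of F, fun A hA hAU => ?_⟩
  by_contra hne
  have hmem : Aᶜ ∈ F := ⟨A, hA, lt_of_le_of_ne (localNorm_le_norm ψ hA) hne, subset_rfl⟩
  exact Ultrafilter.compl_notMem_iff.2 hAU (Ultrafilter.of_le F hmem)

/-- On a non-atomic measure space, an ultrafilter whose measurable members have positive measure
contains a decreasing sequence of measurable sets with empty intersection. -/
theorem IsNonatomic.exists_antitone_mem_ultrafilter [IsFiniteMeasure μ] (hμ : IsNonatomic μ)
    (U : Ultrafilter Ω) (hU : ∀ A : Set Ω, MeasurableSet A → A ∈ U → 0 < μ A) :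
    ∃ D : ℕ → Set Ω, (∀ n, MeasurableSet (D n)) ∧ Antitone D ∧ ⋂ n, D n = ∅ ∧ ∀ n, D n ∈ U := by
  set V : Set ENNReal := μ '' {A | MeasurableSet A ∧ A ∈ U} with hV
  have hne : V.Nonempty := ⟨_, Set.univ, ⟨MeasurableSet.univ, univ_mem⟩, rfl⟩
  obtain ⟨u, -, hu, huV⟩ := exists_seq_tendsto_sInf hne (OrderBot.bddBelow V)
  choose A hA hAu using huV
  set B : Set Ω := ⋂ n, A n with hB
  have hBm : MeasurableSet B := MeasurableSet.iInter fun n => (hA n).1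
  have hBU : B ∉ U := by
    -- Otherwise `B` would have least measure in `U`, yet it splits into two parts of smaller
    -- measure, one of them in `U`.
    intro hBU
    obtain ⟨t, htB, ht, htpos, htlt⟩ := hμ B hBm (hU B hBm hBU)
    have hBle : μ B ≤ sInf V :=
      ge_of_tendsto' hu fun n => (hAu n) ▸ measure_mono (Set.iInter_subset A n)
    have key : ∀ s, MeasurableSet s → s ∈ U → ¬ μ s < μ B := fun s hs hsU hlt =>
      (hlt.trans_le hBle).not_ge (sInf_le ⟨s, ⟨hs, hsU⟩, rfl⟩)
    have htU : t ∉ U := fun h => key t ht h htlt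
    refine key (B \ t) (hBm.diff ht) ?_ ?_
    · exact inter_mem hBU (Ultrafilter.compl_mem_iff_notMem.2 htU)
    · rw [measure_sdiff htB ht.nullMeasurableSet (measure_ne_top μ t)]
      exact ENNReal.sub_lt_self (measure_ne_top μ B) (htpos.trans htlt).ne' htpos.ne'
  refine ⟨fun n => (⋂ i ≤ n, A i) \ B, fun n => ?_, ?_, ?_, fun n => ?_⟩
  · exact (MeasurableSet.iInter fun i => MeasurableSet.iInter fun _ => (hA i).1).diff hBm
  · intro m n hmn
    exact Set.sdiff_subset_sdiff_left
      (Set.biInter_subset_biInter_left fun i (hi : i ≤ m) => hi.trans hmn)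
  · refine Set.eq_empty_iff_forall_notMem.2 fun ω hω => ?_
    rw [Set.mem_iInter] at hω
    exact (hω 0).2 (Set.mem_iInter.2 fun n => Set.mem_iInter₂.1 (hω n).1 n le_rfl)
  · refine inter_mem ?_ (Ultrafilter.compl_mem_iff_notMem.2 hBU)
    exact (biInter_mem (Set.finite_Iic n)).2 fun i _ => (hA i).2

theorem IsNonatomic.exists_antitone_localNorm_eq [IsFiniteMeasure μ] (hμ : IsNonatomic μ)
    {ψ : StrongDual 𝕜 (Lp X 1 μ)} (hψ : ψ ≠ 0) :
    ∃ (D : ℕ → Set Ω) (hD : ∀ n, MeasurableSet (D n)), Antitone D ∧ ⋂ n, D n = ∅ ∧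
      ∀ n, localNorm ψ (hD n) = ‖ψ‖ := by
  obtain ⟨U, hU⟩ := exists_ultrafilter_localNorm_eq hψ
  obtain ⟨D, hD, hanti, hempty, hDU⟩ := hμ.exists_antitone_mem_ultrafilter U fun A hA hAU => by
    refine pos_iff_ne_zero.2 fun h => hψ ?_
    rw [← norm_eq_zero, ← hU A hA hAU, localNorm_eq_zero ψ hA h]
  exact ⟨D, hD, hanti, hempty, fun n => hU _ (hD n) (hDU n)⟩

/-! ### Splicing states -/

/-- The values on the two pieces sum to `1`, as do the norms that bound them, so both bounds are
attained. -/
theorem apply_indicator_eq_norm {f : Lp X 1 μ} (hf : ‖f‖ = 1) {φ : StrongDual 𝕜 (Lp X 1 μ)}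
    (hφ : φ ∈ stateSpace 𝕜 f) {A : Set Ω} (hA : MeasurableSet A) :
    φ (L1.indicator hA f) = (‖L1.indicator hA f‖ : 𝕜) := by
  have hle : ∀ g, ‖φ g‖ ≤ ‖g‖ := fun g => by simpa [hφ.1] using φ.le_opNorm g
  have hsum : φ (L1.indicator hA f) + φ (L1.indicator hA.compl f) = 1 := by
    rw [← map_add, L1.indicator_add_indicator_compl, hφ.2]
  have hre := congrArg RCLike.re hsum
  rw [map_add, RCLike.one_re] at hre
  have h₁ := (RCLike.re_le_norm (φ (L1.indicator hA f))).trans (hle _)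
  have h₂ := (RCLike.re_le_norm (φ (L1.indicator hA.compl f))).trans (hle _)
  have h₃ := L1.norm_indicator_add_compl hA f
  have heq : RCLike.re (φ (L1.indicator hA f)) = ‖L1.indicator hA f‖ := by linarith
  rw [← heq, RCLike.re_eq_self_of_le]
  exact heq ▸ hle _

theorem splice_mem_stateSpace {f : Lp X 1 μ} (hf : ‖f‖ = 1) {φ₁ φ₂ : StrongDual 𝕜 (Lp X 1 μ)}
    (h₁ : φ₁ ∈ stateSpace 𝕜 f) (h₂ : φ₂ ∈ stateSpace 𝕜 f) {A : Set Ω} (hA : MeasurableSet A) :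
    φ₂.comp (L1.indicatorCLM 𝕜 hA) + φ₁.comp (L1.indicatorCLM 𝕜 hA.compl) ∈ stateSpace 𝕜 f := by
  set χ := φ₂.comp (L1.indicatorCLM 𝕜 hA) + φ₁.comp (L1.indicatorCLM 𝕜 hA.compl) with hχ
  have hval : χ f = 1 := by
    simp only [hχ, add_apply, ContinuousLinearMap.comp_apply,
      L1.indicatorCLM_apply]
    rw [apply_indicator_eq_norm hf h₂ hA, apply_indicator_eq_norm hf h₁ hA.compl,
      ← RCLike.ofReal_add, L1.norm_indicator_add_compl, hf, RCLike.ofReal_one]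
  refine ⟨le_antisymm ?_ ?_, hval⟩
  · refine ContinuousLinearMap.opNorm_le_bound _ zero_le_one fun g => ?_
    have b₂ := φ₂.le_opNorm (L1.indicator hA g)
    have b₁ := φ₁.le_opNorm (L1.indicator hA.compl g)
    rw [h₂.1] at b₂
    rw [h₁.1] at b₁
    calc ‖χ g‖ ≤ ‖φ₂ (L1.indicator hA g)‖ + ‖φ₁ (L1.indicator hA.compl g)‖ := norm_add_le _ _
      _ ≤ 1 * ‖g‖ := by linarith [L1.norm_indicator_add_compl hA g]
  · simpa [hval, hf] using χ.le_opNorm f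

end Restriction

/-- If a sequence in a weakly compact set of functionals converges pointwise to `x`, then `x` lies
in the norm closure of every convex set containing the sequence. -/
theorem IsWeaklyCompact.mem_closure_of_tendsto_apply {𝕜 : Type*} [RCLike 𝕜] {E : Type*}
    [NormedAddCommGroup E] [NormedSpace 𝕜 E] {K C : Set (StrongDual 𝕜 E)}
    (hK : IsWeaklyCompact 𝕜 K) (hC : Convex ℝ C) {z : ℕ → StrongDual 𝕜 E}
    (hzK : ∀ n, z n ∈ K) (hzC : ∀ n, z n ∈ C) {x : StrongDual 𝕜 E}
    (hx : ∀ e, Tendsto (fun n => z n e) atTop (𝓝 (x e))) : x ∈ closure C := by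
  set l : Ultrafilter ℕ := hyperfilter ℕ
  have hl : (l : Filter ℕ) ≤ atTop := Nat.hyperfilter_le_atTop
  obtain ⟨-, ⟨y, -, rfl⟩, hy⟩ := hK.ultrafilter_le_nhds'
    (l.map fun n => toWeakSpace 𝕜 (StrongDual 𝕜 E) (z n))
    (Ultrafilter.mem_map.2 (Eventually.of_forall fun n => Set.mem_image_of_mem _ (hzK n)))
  replace hy : Tendsto (fun n => toWeakSpace 𝕜 (StrongDual 𝕜 E) (z n)) l
    (𝓝 (toWeakSpace 𝕜 (StrongDual 𝕜 E) y)) := hy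
  -- Evaluations are weakly continuous, so the weak limit is the pointwise one.
  have hyx : y = x := by
    ext e
    have hcont : Continuous fun w : WeakSpace 𝕜 (StrongDual 𝕜 E) =>
        ((toWeakSpace 𝕜 (StrongDual 𝕜 E)).symm w) e :=
      WeakBilin.eval_continuous (topDualPairing 𝕜 (StrongDual 𝕜 E)).flip
        (ContinuousLinearMap.apply 𝕜 𝕜 e)
    exact tendsto_nhds_unique ((hcont.tendsto _).comp hy) ((hx e).mono_left hl)
  have hmem : toWeakSpace 𝕜 (StrongDual 𝕜 E) y ∈
      closure (toWeakSpace 𝕜 (StrongDual 𝕜 E) '' C) :=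
    mem_closure_of_tendsto hy
      (Eventually.of_forall fun n => Set.mem_image_of_mem _ (hzC n))
  -- Mazur: a convex set has the same weak and norm closure.
  rw [← hC.toWeakSpace_closure 𝕜] at hmem
  obtain ⟨w, hw, hwy⟩ := hmem
  rwa [← hyx, ← (toWeakSpace 𝕜 (StrongDual 𝕜 E)).injective hwy]

theorem IsCompact.isWeaklyCompact {𝕜 : Type*} [RCLike 𝕜] {E : Type*} [NormedAddCommGroup E]
    [NormedSpace 𝕜 E] {K : Set E} (hK : IsCompact K) : IsWeaklyCompact 𝕜 K :=
  hK.image (toWeakSpaceCLM 𝕜 E).continuous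

theorem subsingleton_stateSpace_of_isWeaklyCompact {𝕜 : Type*} [RCLike 𝕜] {Ω : Type*}
    [MeasurableSpace Ω] {μ : Measure Ω} [IsFiniteMeasure μ] (hμ : IsNonatomic μ) {X : Type*}
    [NormedAddCommGroup X] [NormedSpace 𝕜 X] {f : Lp X 1 μ} (hf : ‖f‖ = 1)
    (hS : IsWeaklyCompact 𝕜 (stateSpace 𝕜 f)) : (stateSpace 𝕜 f).Subsingleton := by
  intro φ₁ h₁ φ₂ h₂
  by_contra hne
  have hψ : φ₁ - φ₂ ≠ 0 := sub_ne_zero.2 hne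
  obtain ⟨D, hD, hanti, hempty, hnorm⟩ := hμ.exists_antitone_localNorm_eq hψ
  -- the functionals that agree with `φ₂` on the functions supported in some `D n`
  let C : Set (StrongDual 𝕜 (Lp X 1 μ)) :=
    {χ | ∃ n, ∀ A (hA : MeasurableSet A), A ⊆ D n → ∀ g, χ (L1.indicator hA g) =
      φ₂ (L1.indicator hA g)}
  -- The `D n` are nested, so two members of `C` agree with `φ₂` on a common `D n`.
  have hC : Convex ℝ C := by
    rintro χ ⟨m, hm⟩ χ' ⟨n, hn⟩ a b - - hab
    refine ⟨max m n, fun A hA hAD g => ?_⟩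
    rw [add_apply, smul_apply,
      smul_apply, hm A hA (hAD.trans (hanti (le_max_left m n))),
      hn A hA (hAD.trans (hanti (le_max_right m n))), ← add_smul, hab, one_smul]
  have hmem : φ₁ ∈ closure C := by
    refine hS.mem_closure_of_tendsto_apply hC
      (fun n => splice_mem_stateSpace hf h₁ h₂ (hD n)) (fun n => ?_) fun g => ?_
    · refine ⟨n, fun A hA hAD g => ?_⟩
      simp only [add_apply, ContinuousLinearMap.comp_apply,
        L1.indicatorCLM_apply]
      rw [L1.indicator_indicator_of_subset hA (hD n) hAD, L1.indicator_indicator,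
        L1.indicator_eq_zero ((hD n).compl.inter hA), map_zero, add_zero]
      rw [Set.disjoint_iff_inter_eq_empty.1 (Set.disjoint_compl_left_iff_subset.2 hAD),
        measure_empty]
    · have hlim := L1.tendsto_indicator_zero hD hanti hempty g
      have heq : ∀ n, (φ₂.comp (L1.indicatorCLM 𝕜 (hD n)) +
          φ₁.comp (L1.indicatorCLM 𝕜 (hD n).compl)) g =
          φ₂ (L1.indicator (hD n) g) + φ₁ (g - L1.indicator (hD n) g) := fun n => by
        nth_rewrite 3 [← L1.indicator_add_indicator_compl (hD n) g]
        rw [add_sub_cancel_left]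
        rfl
      simp only [heq]
      have h := ((φ₂.continuous.tendsto 0).comp hlim).add
        ((φ₁.continuous.tendsto (g - 0)).comp (tendsto_const_nhds.sub hlim))
      simpa using h
  obtain ⟨χ, ⟨n, hχ⟩, hdist⟩ := Metric.mem_closure_iff.1 hmem _ (norm_pos_iff.2 hψ)
  refine hdist.not_ge ?_
  -- On `D n`, `φ₁ - χ` coincides with `ψ`, which has full norm there.
  have hcomp : (φ₁ - φ₂).comp (L1.indicatorCLM 𝕜 (hD n)) =
      (φ₁ - χ).comp (L1.indicatorCLM 𝕜 (hD n)) := by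
    ext g
    simp [hχ (D n) (hD n) subset_rfl g]
  rw [dist_eq_norm, ← hnorm n, localNorm, hcomp]
  exact localNorm_le_norm (φ₁ - χ) (hD n)

theorem corollary3p7 {𝕜 : Type*} [RCLike 𝕜]
    {Ω : Type*} [MeasurableSpace Ω] (μ : Measure Ω) [IsProbabilityMeasure μ]
    (hμ : IsNonatomic μ)
    {X : Type*} [NormedAddCommGroup X] [NormedSpace 𝕜 X] [CompleteSpace X]
    (hX : HasRNPWith μ (StrongDual 𝕜 X))
    (f : Lp X 1 μ) (hf : ‖f‖ = 1)
    (hS : IsWeaklyCompact 𝕜 (stateSpace 𝕜 f) ∨ IsCompact (stateSpace 𝕜 f)) :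
    IsSmoothPoint 𝕜 f := by
  have hsub : (stateSpace 𝕜 f).Subsingleton :=
    subsingleton_stateSpace_of_isWeaklyCompact hμ hf (hS.elim id IsCompact.isWeaklyCompact)
  -- Hahn–Banach: the state space is nonempty.
  obtain ⟨φ, hφ, hφf⟩ := exists_dual_vector 𝕜 f (by rw [hf]; exact one_ne_zero)
  rw [hf, RCLike.ofReal_one] at hφf
  exact ⟨hf, φ, hsub.eq_singleton_of_mem ⟨hφ, hφf⟩⟩
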